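/- Let $\mathcal H_A,\mathcal H_B$ be finite-dimensional complex Hilbert spaces with fixed reference orthonormal bases, and use the product basis on $\mathcal H_A\otimes\mathcal H_B$. For a state $\rho$ (positive semidefinite, trace one) on $\mathcal H_A\otimes\mathcal H_B$ let $\rho^{T_A}$ be its partial transpose on $A$, let $\mathcal N(\rho)=\operatorname{tr}|\rho^{T_A}|-1$ be its negativity, where $|X|=(X^\dagger X)^{1/2}$, and let $C_{l_1}(\rho)=\sum_{j\neq k}|\rho_{jk}|$ be its $l_1$-norm of coherence in the product basis. Call $\rho$ a pairing state if $\mathcal N(\rho)=C_{l_1}(U\rho U^\dagger)$ for some local unitary $U=U_A\otimes U_B$. A PPT operation is a completely positive trace-preserving linear map $\Psi$ from operators on a bipartite system $AB$ to operators on a bipartite system $A'B'$ such that the map $X\mapsto\Psi(X^{T_A})^{T_{A'}}$ is also completely positive. Let $\Phi_d=\frac1d\sum_{i,k=1}^d|ii\rangle\langle kk|$ be the maximally entangled state on $\mathbb C^d\otimes\mathbb C^d$. The asymptotic exact PPT entanglement cost $E_{\mathrm{PPT}}(\rho)$ is the infimum of all real $r$ such that, for all sufficiently large $n$, there are an integer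 $d\ge1$ with $\log_2 d\le rn$ and a PPT operation $\Psi$ with $\Psi(\Phi_d)=\rho^{\otimes n}$, where $\rho^{\otimes n}$ is regarded as a bipartite state across the cut $A^n:B^n$ (and $E_{\mathrm{PPT}}(\rho)=+\infty$ if there is no such $r$). Theorem. For every pairing state $\rho$ on $\mathcal H_A\otimes\mathcal H_B$, the asymptotic exact PPT entanglement cost equals the logarithmic negativity: $$E_{\mathrm{PPT}}(\rho)=\log_2\bigl(1+\mathcal N(\rho)\bigr).$$ -/

import Mathlib

open scoped ComplexOrder MatrixOrder Kronecker

/-! A bipartite operator on `ℋ_A ⊗ ℋ_B` (finite-dimensional, with reference orthonormal bases indexed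
by `a` and `b`) is its matrix in the product basis, indexed by `a × b`. -/

namespace PairingState

noncomputable section

/-- A quantum state: a positive semidefinite matrix of trace one. -/
structure IsState {ι : Type*} [Fintype ι] (ρ : Matrix ι ι ℂ) : Prop where
  posSemidef : ρ.PosSemidef
  trace_eq_one : ρ.trace = 1

/-- The partial transpose `X ↦ X^{T_A}` with respect to the first subsystem. -/
def partialTranspose (a b : Type*) :
    Matrix (a × b) (a × b) ℂ →ₗ[ℂ] Matrix (a × b) (a × b) ℂ where
  toFun X := Matrix.of fun p q => X (q.1, p.2) (p.1, q.2)
  map_add' _ _ := rfl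
  map_smul' _ _ := rfl

/-- The trace norm `‖X‖₁ = tr |X|`, where `|X| = (X† X)^{1/2}`. -/
def traceNorm {ι : Type*} [Fintype ι] [DecidableEq ι] (X : Matrix ι ι ℂ) : ℝ :=
  (CFC.abs X).trace.re

/-- The `l₁`-norm of coherence: the sum of the moduli of the off-diagonal entries. -/
def coherenceL1 {ι : Type*} [Fintype ι] [DecidableEq ι] (ρ : Matrix ι ι ℂ) : ℝ :=
  ∑ i, ∑ j, if i = j then 0 else ‖ρ i j‖

section Bipartite

variable {a b : Type*} [Fintype a] [DecidableEq a] [Fintype b] [DecidableEq b]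

/-- The negativity `𝒩(ρ) = ‖ρ^{T_A}‖₁ - 1`. -/
def negativity (ρ : Matrix (a × b) (a × b) ℂ) : ℝ :=
  traceNorm (partialTranspose a b ρ) - 1

/-- The logarithmic negativity `𝒩_L(ρ) = log₂ (1 + 𝒩(ρ))`. -/
def logNegativity (ρ : Matrix (a × b) (a × b) ℂ) : ℝ :=
  Real.logb 2 (1 + negativity ρ)

/-- A pairing state: a bipartite state `ρ` with `𝒩(ρ) = C_{l₁}(U ρ U†)` for some local unitary
`U = U_A ⊗ U_B`. -/
def IsPairingState (ρ : Matrix (a × b) (a × b) ℂ) : Prop :=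
  IsState ρ ∧ ∃ UA ∈ Matrix.unitaryGroup a ℂ, ∃ UB ∈ Matrix.unitaryGroup b ℂ,
    negativity ρ = coherenceL1 ((UA ⊗ₖ UB) * ρ * (UA ⊗ₖ UB).conjTranspose)

/-- The `n`-fold tensor power `ρ^{⊗ n}`, as a bipartite operator for the cut `A^n : B^n`. -/
def tensorPower (ρ : Matrix (a × b) (a × b) ℂ) (n : ℕ) :
    Matrix ((Fin n → a) × (Fin n → b)) ((Fin n → a) × (Fin n → b)) ℂ :=
  Matrix.of fun p q => ∏ i, ρ (p.1 i, p.2 i) (q.1 i, q.2 i)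

end Bipartite

/-- The maximally entangled state `Φ_d = d⁻¹ ∑_{i,k} |ii⟩⟨kk|` on `ℂ^d ⊗ ℂ^d`. -/
def maxEntangled (d : ℕ) : Matrix (Fin d × Fin d) (Fin d × Fin d) ℂ :=
  Matrix.of fun p q => if p.1 = p.2 ∧ q.1 = q.2 then (d : ℂ)⁻¹ else 0

/-- Complete positivity of a linear map `Ψ` between matrix algebras: `id_k ⊗ Ψ` (that is, `Ψ` applied
to each block of a `k × k` block matrix) preserves positive semidefiniteness for every `k`. -/
def IsCompletelyPositive {ι κ : Type*} (Ψ : Matrix ι ι ℂ →ₗ[ℂ] Matrix κ κ ℂ) : Prop :=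
  ∀ (k : ℕ) (M : Matrix (Fin k × ι) (Fin k × ι) ℂ), M.PosSemidef →
    (Matrix.of fun p q : Fin k × κ =>
      Ψ (Matrix.of fun x y => M (p.1, x) (q.1, y)) p.2 q.2).PosSemidef

/-- A PPT operation from `A B` to `A' B'`: a completely positive trace-preserving map `Ψ` such that
`T_{A'} ∘ Ψ ∘ T_A` is completely positive as well. -/
structure IsPPTOperation {a b a' b' : Type*} [Fintype a] [Fintype b] [Fintype a'] [Fintype b']
    (Ψ : Matrix (a × b) (a × b) ℂ →ₗ[ℂ] Matrix (a' × b') (a' × b') ℂ) : Prop where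
  completelyPositive : IsCompletelyPositive Ψ
  tracePreserving : ∀ X, (Ψ X).trace = X.trace
  ppt : IsCompletelyPositive (partialTranspose a' b' ∘ₗ Ψ ∘ₗ partialTranspose a b)

section Cost

variable {a b : Type*} [Fintype a] [DecidableEq a] [Fintype b] [DecidableEq b]

/-- The rate `r` (in ebits per copy) is achievable for the exact preparation of `ρ`: for all
sufficiently large `n`, a PPT operation converts some `Φ_d` with `log₂ d ≤ r n` exactly into
`ρ^{⊗ n}`. -/
def IsAchievableRate (ρ : Matrix (a × b) (a × b) ℂ) (r : ℝ) : Prop :=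
  ∀ᶠ n : ℕ in Filter.atTop, ∃ d : ℕ, 0 < d ∧ Real.logb 2 d ≤ r * n ∧
    ∃ Ψ : Matrix (Fin d × Fin d) (Fin d × Fin d) ℂ →ₗ[ℂ]
        Matrix ((Fin n → a) × (Fin n → b)) ((Fin n → a) × (Fin n → b)) ℂ,
      IsPPTOperation Ψ ∧ Ψ (maxEntangled d) = tensorPower ρ n

/-- The asymptotic exact PPT entanglement cost: the infimum of the achievable rates (taken in the
extended reals, so that it would be `⊤` if no rate were achievable). -/
def exactPPTCost (ρ : Matrix (a × b) (a × b) ℂ) : EReal :=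
  sInf ((fun r : ℝ => (r : EReal)) '' {r : ℝ | IsAchievableRate ρ r})

end Cost

end

end PairingState

/-! For Hermitian `X` with sign `W`, `tr |X| = tr (X W)`, and the entries of `W` have modulus at
most 1, so `tr |X|` is at most the sum of the moduli of the entries of `X`; equality forces `|X|` to
be diagonal (`abs_apply_eq_zero_of_traceNorm_eq`). Partial transposition only permutes entries, so
for a state this sum is one plus the coherence. The pairing condition is thus the equality case in a
rotated local basis: there `|ρ^{T_A}|` is diagonal, hence fixed by `T_A`, and so `|ρ^{T_A}|^{T_A} ≥
0` in every local basis.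

This positivity makes the cost computable. A PPT operation from `Φ_d` cannot produce trace norm
above `d` (`IsPPTOperation.traceNorm_partialTranspose_le`), while an explicit measure-and-prepare
map reaches the target once `d` exceeds that norm by 1 (`exists_isPPTOperation`). Trace norm and
positivity pass to tensor powers, so the extra 1 vanishes in the rate. -/

namespace PairingState

/-! ### Trace norm, sign matrices and the equality case. -/

section TraceNorm

variable {ι : Type*} [Fintype ι] [DecidableEq ι]

/-- The absolute value of a matrix is characterised as the positive square root of `X† X`. -/
theorem abs_eq_of_posSemidef {X P : Matrix ι ι ℂ} (hP : P.PosSemidef)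
    (h : P * P = X.conjTranspose * X) : CFC.abs X = P :=
  CFC.sqrt_unique h hP.nonneg

theorem posSemidef_abs (X : Matrix ι ι ℂ) : (CFC.abs X).PosSemidef :=
  Matrix.nonneg_iff_posSemidef.1 (CFC.abs_nonneg X)

theorem traceNorm_eq_trace (X : Matrix ι ι ℂ) : (traceNorm X : ℂ) = (CFC.abs X).trace := by
  have h := (posSemidef_abs X).trace_nonneg
  exact Complex.ext rfl (by simpa using (Complex.nonneg_iff.1 h).2)

theorem posSemidef_one_add_of_involutive {W : Matrix ι ι ℂ} (hW : W.IsHermitian)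
    (hW2 : W * W = 1) : (1 + W).PosSemidef := by
  have h : 1 + W = (2⁻¹ : ℂ) • ((1 + W).conjTranspose * (1 + W)) := by
    rw [Matrix.conjTranspose_add, hW.eq, Matrix.conjTranspose_one, mul_add, add_mul, add_mul, hW2]
    simp only [one_mul, mul_one]
    module
  rw [h]
  exact (Matrix.posSemidef_conjTranspose_mul_self _).smul (inv_nonneg.2 zero_le_two)

theorem posSemidef_one_sub_of_involutive {W : Matrix ι ι ℂ} (hW : W.IsHermitian)
    (hW2 : W * W = 1) : (1 - W).PosSemidef := by
  rw [sub_eq_add_neg]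
  exact posSemidef_one_add_of_involutive hW.neg (by rw [neg_mul_neg, hW2])

/-- Polar decomposition of a Hermitian matrix with a Hermitian unitary. -/
theorem exists_sign {X : Matrix ι ι ℂ} (hX : X.IsHermitian) :
    ∃ W : Matrix ι ι ℂ, W.IsHermitian ∧ W * W = 1 ∧ CFC.abs X = X * W := by
  have hX' : IsSelfAdjoint X := hX
  have hfin : (spectrum ℝ X).Finite := Matrix.finite_real_spectrum
  have hc : ∀ f : ℝ → ℝ, ContinuousOn f (spectrum ℝ X) := fun f => hfin.continuousOn f
  -- The value 1 at 0, instead of 0, is what makes `W * W = 1` when `X` is singular.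
  refine ⟨cfc (fun x : ℝ => if x < 0 then (-1 : ℝ) else 1) X, ?_, ?_, ?_⟩
  · exact cfc_predicate (R := ℝ) _ X
  · rw [← cfc_mul _ _ X (hc _) (hc _), ← cfc_one ℝ X]
    congr 1
    ext x
    split_ifs <;> simp
  · rw [CFC.abs_eq_cfc_norm X]
    conv_rhs => enter [1]; rw [← cfc_id ℝ X]
    rw [← cfc_mul _ _ X (hc _) (hc _)]
    congr 1
    ext x
    split_ifs with h
    · simp [abs_of_neg h]
    · simp [abs_of_nonneg (not_lt.1 h)]

theorem trace_mul_nonneg {P Q : Matrix ι ι ℂ} (hP : P.PosSemidef) (hQ : Q.PosSemidef) :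
    0 ≤ (P * Q).trace := by
  obtain ⟨B, rfl⟩ := CStarAlgebra.nonneg_iff_eq_star_mul_self.1 hQ.nonneg
  rw [← mul_assoc, Matrix.trace_mul_comm, ← mul_assoc]
  exact (hP.mul_mul_conjTranspose_same B).trace_nonneg

/-- With `W` the sign of `P - Q`, use `tr (P W) ≤ tr P` and `-tr (Q W) ≤ tr Q`, as `1 ± W ≥ 0`. -/
theorem traceNorm_sub_le {P Q : Matrix ι ι ℂ} (hP : P.PosSemidef) (hQ : Q.PosSemidef) :
    traceNorm (P - Q) ≤ (P.trace + Q.trace).re := by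
  obtain ⟨W, hW, hW2, hX⟩ := exists_sign (hP.isHermitian.sub hQ.isHermitian)
  have h1 := trace_mul_nonneg hP (posSemidef_one_sub_of_involutive hW hW2)
  have h2 := trace_mul_nonneg hQ (posSemidef_one_add_of_involutive hW hW2)
  have h1 := (Complex.nonneg_iff.1 h1).1
  have h2 := (Complex.nonneg_iff.1 h2).1
  rw [mul_sub, mul_one, Matrix.trace_sub, Complex.sub_re] at h1
  rw [mul_add, mul_one, Matrix.trace_add, Complex.add_re] at h2
  rw [traceNorm, hX, sub_mul, Matrix.trace_sub, Complex.sub_re, Complex.add_re]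
  linarith

theorem posSemidef_abs_sub {X : Matrix ι ι ℂ} (hX : X.IsHermitian) :
    (CFC.abs X - X).PosSemidef := by
  have hX' : IsSelfAdjoint X := hX
  rw [← Matrix.nonneg_iff_posSemidef, CFC.abs_sub_self X]
  exact nsmul_nonneg (CFC.negPart_nonneg X) 2

theorem posSemidef_abs_add {X : Matrix ι ι ℂ} (hX : X.IsHermitian) :
    (CFC.abs X + X).PosSemidef := by
  have hX' : IsSelfAdjoint X := hX
  rw [← Matrix.nonneg_iff_posSemidef, CFC.abs_add_self X]
  exact nsmul_nonneg (CFC.posPart_nonneg X) 2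

theorem abs_unitary_conj {X V : Matrix ι ι ℂ} (hV : V ∈ Matrix.unitaryGroup ι ℂ) :
    CFC.abs (V * X * V.conjTranspose) = V * CFC.abs X * V.conjTranspose := by
  have hV' : V.conjTranspose * V = 1 := Matrix.mem_unitaryGroup_iff'.1 hV
  refine abs_eq_of_posSemidef ((posSemidef_abs X).mul_mul_conjTranspose_same V) ?_
  have key : ∀ A B : Matrix ι ι ℂ, V * A * V.conjTranspose * (V * B * V.conjTranspose)
      = V * (A * B) * V.conjTranspose := fun A B => by
    calc _ = V * A * (V.conjTranspose * V) * B * V.conjTranspose := by simp only [mul_assoc]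
      _ = _ := by rw [hV']; simp only [mul_assoc, one_mul]
  rw [key, Matrix.conjTranspose_mul, Matrix.conjTranspose_mul, Matrix.conjTranspose_conjTranspose,
    ← mul_assoc V X.conjTranspose, key, CFC.abs_mul_abs]
  rfl

theorem sum_norm_sq_row_of_involutive {W : Matrix ι ι ℂ} (hW : W.IsHermitian)
    (hW2 : W * W = 1) (i : ι) : ∑ k, ‖W i k‖ ^ 2 = 1 := by
  have h := congrFun (congrFun hW2 i) i
  rw [Matrix.mul_apply, Matrix.one_apply_eq] at h
  have hsum : ((∑ k, ‖W i k‖ ^ 2 : ℝ) : ℂ) = 1 := by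
    rw [← h]
    push_cast
    refine Finset.sum_congr rfl fun k _ => ?_
    rw [← hW.apply k i, ← Complex.mul_conj']
    rfl
  exact_mod_cast hsum

/-- If the trace norm of a Hermitian matrix attains the sum of the moduli of its entries, then its
absolute value is diagonal. -/
theorem abs_apply_eq_zero_of_traceNorm_eq {X : Matrix ι ι ℂ} (hX : X.IsHermitian)
    (h : traceNorm X = ∑ i, ∑ j, ‖X i j‖) {i k : ι} (hik : i ≠ k) : CFC.abs X i k = 0 := by
  obtain ⟨W, hW, hW2, hA⟩ := exists_sign hX
  have hrow := sum_norm_sq_row_of_involutive hW hW2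
  have hle : ∀ i j, ‖W i j‖ ≤ 1 := fun i j => by
    have := Finset.single_le_sum (f := fun k => ‖W i k‖ ^ 2) (fun k _ => by positivity)
      (Finset.mem_univ j)
    rw [hrow] at this
    exact (sq_le_one_iff₀ (norm_nonneg _)).1 this
  have hterm : ∀ i j, (X i j * W j i).re ≤ ‖X i j‖ := fun i j =>
    (Complex.re_le_norm _).trans <| by
      rw [norm_mul]; exact mul_le_of_le_one_right (norm_nonneg _) (hle _ _)
  have hsum : ∑ i, ∑ j, (X i j * W j i).re = ∑ i, ∑ j, ‖X i j‖ := by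
    rw [← h, traceNorm, hA]
    simp [Matrix.trace, Matrix.mul_apply]
  have heq : ∀ i j, (X i j * W j i).re = ‖X i j‖ := fun i j => by
    have h1 := (Finset.sum_eq_sum_iff_of_le
      (fun i _ => Finset.sum_le_sum fun j _ => hterm i j)).1 hsum i (Finset.mem_univ i)
    exact (Finset.sum_eq_sum_iff_of_le (fun j _ => hterm i j)).1 h1 j (Finset.mem_univ j)
  rw [hA, Matrix.mul_apply]
  refine Finset.sum_eq_zero fun j _ => ?_
  by_cases hx : X i j = 0
  · rw [hx, zero_mul]
  have hpos : 0 < ‖X i j‖ := norm_pos_iff.2 hx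
  -- Row `j` of `W` is a unit vector, so an entry of modulus 1 at `i` leaves nothing at `k`.
  have hone : 1 ≤ ‖W j i‖ := by
    have := Complex.re_le_norm (X i j * W j i)
    rw [heq, norm_mul] at this
    exact (le_mul_iff_one_le_right hpos).1 this
  have h2 : ‖W j i‖ ^ 2 + ‖W j k‖ ^ 2 ≤ 1 := by
    rw [← hrow j, ← Finset.sum_pair (f := fun k => ‖W j k‖ ^ 2) hik]
    exact Finset.sum_le_sum_of_subset_of_nonneg (Finset.subset_univ _) fun _ _ _ => by positivity
  have h3 : ‖W j k‖ = 0 := by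
    have := norm_nonneg (W j k)
    nlinarith
  rw [norm_eq_zero.1 h3, mul_zero]

end TraceNorm

/-! ### Multiplicativity under tensor powers. -/

section TensorPower

variable {a b : Type*}

theorem conjTranspose_tensorPower (M : Matrix (a × b) (a × b) ℂ) (n : ℕ) :
    (tensorPower M n).conjTranspose = tensorPower M.conjTranspose n := by
  ext p q
  simp [tensorPower, Matrix.conjTranspose_apply]

variable [Fintype a] [Fintype b]

theorem prod_sum_prod_eq_sum_prod {R : Type*} [CommSemiring R] {n : ℕ}
    (f : Fin n → a × b → R) :
    ∏ i, ∑ x, f i x = ∑ p : (Fin n → a) × (Fin n → b), ∏ i, f i (p.1 i, p.2 i) := by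
  rw [Finset.prod_univ_sum, Fintype.piFinset_univ]
  exact Fintype.sum_equiv (Equiv.arrowProdEquivProdArrow (Fin n) (fun _ => a) (fun _ => b)) _ _
    fun _ => rfl

theorem tensorPower_mul (M N : Matrix (a × b) (a × b) ℂ) (n : ℕ) :
    tensorPower (M * N) n = tensorPower M n * tensorPower N n := by
  ext p q
  simp only [tensorPower, Matrix.of_apply, Matrix.mul_apply]
  rw [prod_sum_prod_eq_sum_prod]
  simp only [Finset.prod_mul_distrib]

theorem trace_tensorPower (M : Matrix (a × b) (a × b) ℂ) (n : ℕ) :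
    (tensorPower M n).trace = M.trace ^ n := by
  simp only [Matrix.trace, Matrix.diag_apply, tensorPower, Matrix.of_apply]
  rw [← prod_sum_prod_eq_sum_prod (fun _ x => M x x), Finset.prod_const, Finset.card_univ,
    Fintype.card_fin]

variable [DecidableEq a] [DecidableEq b]

theorem posSemidef_tensorPower {M : Matrix (a × b) (a × b) ℂ} (hM : M.PosSemidef) (n : ℕ) :
    (tensorPower M n).PosSemidef := by
  obtain ⟨B, rfl⟩ := CStarAlgebra.nonneg_iff_eq_star_mul_self.1 hM.nonneg
  rw [Matrix.star_eq_conjTranspose, tensorPower_mul, ← conjTranspose_tensorPower]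
  exact Matrix.posSemidef_conjTranspose_mul_self _

theorem abs_tensorPower (M : Matrix (a × b) (a × b) ℂ) (n : ℕ) :
    CFC.abs (tensorPower M n) = tensorPower (CFC.abs M) n := by
  refine abs_eq_of_posSemidef (posSemidef_tensorPower (posSemidef_abs M) n) ?_
  rw [← tensorPower_mul, CFC.abs_mul_abs, conjTranspose_tensorPower, ← tensorPower_mul]
  rfl

theorem traceNorm_tensorPower (M : Matrix (a × b) (a × b) ℂ) (n : ℕ) :
    traceNorm (tensorPower M n) = traceNorm M ^ n := by
  have h : (traceNorm (tensorPower M n) : ℂ) = (traceNorm M : ℂ) ^ n := by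
    rw [traceNorm_eq_trace, abs_tensorPower, trace_tensorPower, traceNorm_eq_trace]
  exact_mod_cast h

theorem IsState.tensorPower {ρ : Matrix (a × b) (a × b) ℂ} (hρ : IsState ρ) (n : ℕ) :
    IsState (tensorPower ρ n) :=
  ⟨posSemidef_tensorPower hρ.posSemidef n, by rw [trace_tensorPower, hρ.trace_eq_one, one_pow]⟩

end TensorPower

/-! ### Algebra of the partial transpose. -/

section PartialTranspose

variable {a b : Type*}

theorem partialTranspose_apply (X : Matrix (a × b) (a × b) ℂ) (p q : a × b) :
    partialTranspose a b X p q = X (q.1, p.2) (p.1, q.2) := rfl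

theorem partialTranspose_partialTranspose (X : Matrix (a × b) (a × b) ℂ) :
    partialTranspose a b (partialTranspose a b X) = X := rfl

theorem partialTranspose_tensorPower (X : Matrix (a × b) (a × b) ℂ) (n : ℕ) :
    partialTranspose (Fin n → a) (Fin n → b) (tensorPower X n)
      = tensorPower (partialTranspose a b X) n := rfl

theorem partialTranspose_one [DecidableEq a] [DecidableEq b] : partialTranspose a b 1 = 1 := by
  ext p q
  simp only [partialTranspose_apply, Matrix.one_apply, Prod.ext_iff]
  congr 1
  rw [eq_comm (a := q.1)]

theorem isHermitian_partialTranspose {X : Matrix (a × b) (a × b) ℂ} (hX : X.IsHermitian) :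
    (partialTranspose a b X).IsHermitian := by
  ext p q
  exact hX.apply _ _

variable [Fintype a] [Fintype b]

theorem trace_partialTranspose (X : Matrix (a × b) (a × b) ℂ) :
    (partialTranspose a b X).trace = X.trace := rfl

/-- Exchanging the two `a`-indices is an involution of the entry positions. -/
theorem sum_sum_swap_fst (f : a × b → a × b → ℂ) :
    ∑ p, ∑ q, f p q = ∑ p : a × b, ∑ q : a × b, f (q.1, p.2) (p.1, q.2) := by
  rw [← Fintype.sum_prod_type', ← Fintype.sum_prod_type']
  exact Finset.sum_nbij' (fun x => ((x.2.1, x.1.2), (x.1.1, x.2.2)))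
    (fun x => ((x.2.1, x.1.2), (x.1.1, x.2.2))) (by simp) (by simp) (by simp) (by simp) (by simp)

theorem trace_mul_partialTranspose (X Y : Matrix (a × b) (a × b) ℂ) :
    (X * partialTranspose a b Y).trace = (partialTranspose a b X * Y).trace := by
  simp only [Matrix.trace, Matrix.diag_apply, Matrix.mul_apply, partialTranspose_apply]
  rw [sum_sum_swap_fst]

/-- Local operators pass through the partial transpose, up to a transpose on the first factor. -/
theorem partialTranspose_kronecker_mul_mul (R S : Matrix a a ℂ) (T U : Matrix b b ℂ)
    (X : Matrix (a × b) (a × b) ℂ) :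
    partialTranspose a b ((R ⊗ₖ T) * X * (S ⊗ₖ U))
      = (S.transpose ⊗ₖ T) * partialTranspose a b X * (R.transpose ⊗ₖ U) := by
  ext p q
  simp only [partialTranspose_apply, Matrix.mul_apply, Matrix.kroneckerMap_apply, Finset.sum_mul]
  rw [sum_sum_swap_fst]
  refine Finset.sum_congr rfl fun x _ => Finset.sum_congr rfl fun y _ => ?_
  simp only [Matrix.transpose_apply]
  ring

theorem sum_norm_partialTranspose (X : Matrix (a × b) (a × b) ℂ) :
    ∑ i, ∑ j, ‖partialTranspose a b X i j‖ = ∑ i, ∑ j, ‖X i j‖ := by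
  have h := sum_sum_swap_fst (fun p q => (‖X p q‖ : ℂ))
  exact_mod_cast h.symm

end PartialTranspose

/-! ### Binegativity of pairing states. -/

section Pairing

variable {a b : Type*} [Fintype a] [DecidableEq a] [Fintype b] [DecidableEq b]

theorem sum_norm_entries_of_isState {ι : Type*} [Fintype ι] [DecidableEq ι] {ρ : Matrix ι ι ℂ}
    (hρ : IsState ρ) : ∑ i, ∑ j, ‖ρ i j‖ = 1 + coherenceL1 ρ := by
  have hd : ∑ i, ‖ρ i i‖ = 1 := by
    have h := hρ.trace_eq_one
    have hsum : ((∑ i, ‖ρ i i‖ : ℝ) : ℂ) = 1 := by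
      rw [← h, Matrix.trace]
      push_cast
      exact Finset.sum_congr rfl fun i _ => Complex.norm_of_nonneg' hρ.posSemidef.diag_nonneg
    exact_mod_cast hsum
  rw [← hd, coherenceL1, ← Finset.sum_add_distrib]
  refine Finset.sum_congr rfl fun i _ => ?_
  have hi : ‖ρ i i‖ = ∑ j, if i = j then ‖ρ i j‖ else 0 := by simp
  rw [hi, ← Finset.sum_add_distrib]
  refine Finset.sum_congr rfl fun j _ => ?_
  split_ifs <;> simp

theorem IsState.unitary_conj {ι : Type*} [Fintype ι] [DecidableEq ι] {ρ U : Matrix ι ι ℂ}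
    (hρ : IsState ρ) (hU : U ∈ Matrix.unitaryGroup ι ℂ) :
    IsState (U * ρ * U.conjTranspose) := by
  refine ⟨hρ.posSemidef.mul_mul_conjTranspose_same U, ?_⟩
  rw [Matrix.trace_mul_comm, ← mul_assoc, ← Matrix.star_eq_conjTranspose,
    Matrix.mem_unitaryGroup_iff'.1 hU, one_mul, hρ.trace_eq_one]

/-- The binegativity of a pairing state vanishes. -/
theorem IsPairingState.posSemidef_partialTranspose_abs {ρ : Matrix (a × b) (a × b) ℂ}
    (hρ : IsPairingState ρ) :
    (partialTranspose a b (CFC.abs (partialTranspose a b ρ))).PosSemidef := by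
  obtain ⟨hst, UA, hUA, UB, hUB, h⟩ := hρ
  have hU : UA ⊗ₖ UB ∈ Matrix.unitaryGroup (a × b) ℂ := Matrix.kronecker_mem_unitary hUA hUB
  -- Conjugation by `UA ⊗ UB` becomes, after `T_A`, conjugation by the entrywise conjugate of `UA`
  -- tensored with `UB`.
  have hUc : UA.conjTranspose.transpose ∈ Matrix.unitaryGroup a ℂ :=
    Matrix.map_star_mem_unitaryGroup_iff.2 hUA
  have hV : UA.conjTranspose.transpose ⊗ₖ UB ∈ Matrix.unitaryGroup (a × b) ℂ :=
    Matrix.kronecker_mem_unitary hUc hUB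
  have hVc : (UA.conjTranspose.transpose ⊗ₖ UB).conjTranspose
      = UA.transpose ⊗ₖ UB.conjTranspose := by
    rw [Matrix.conjTranspose_kronecker]
    congr 1
    ext i j
    simp
  set X := partialTranspose a b ρ with hX
  set V := UA.conjTranspose.transpose ⊗ₖ UB with hVdef
  set σ := (UA ⊗ₖ UB) * ρ * (UA ⊗ₖ UB).conjTranspose with hσ
  have hσst : IsState σ := hst.unitary_conj hU
  have hY : partialTranspose a b σ = V * X * V.conjTranspose := by
    rw [hσ, hVc, Matrix.conjTranspose_kronecker, partialTranspose_kronecker_mul_mul]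
  have habs : CFC.abs (partialTranspose a b σ) = V * CFC.abs X * V.conjTranspose := by
    rw [hY, abs_unitary_conj hV]
  have hVV : V.conjTranspose * V = 1 := Matrix.mem_unitaryGroup_iff'.1 hV
  have htn : traceNorm (partialTranspose a b σ) = traceNorm X := by
    rw [traceNorm, habs, Matrix.trace_mul_comm, ← mul_assoc, hVV, one_mul, traceNorm]
  have hsum : traceNorm (partialTranspose a b σ)
      = ∑ i, ∑ j, ‖partialTranspose a b σ i j‖ := by
    rw [htn, sum_norm_partialTranspose, sum_norm_entries_of_isState hσst, ← h, negativity]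
    ring
  have hherm : (partialTranspose a b σ).IsHermitian :=
    isHermitian_partialTranspose hσst.posSemidef.isHermitian
  have hdiag : partialTranspose a b (CFC.abs (partialTranspose a b σ))
      = CFC.abs (partialTranspose a b σ) := by
    ext p q
    rw [partialTranspose_apply]
    by_cases hpq : p = q
    · rw [hpq]
    · rw [abs_apply_eq_zero_of_traceNorm_eq hherm hsum hpq,
        abs_apply_eq_zero_of_traceNorm_eq hherm hsum]
      intro h'
      rw [Prod.ext_iff] at h'
      exact hpq (Prod.ext h'.1.symm h'.2)
  have hback : CFC.abs X = V.conjTranspose * CFC.abs (partialTranspose a b σ) * V := by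
    rw [habs]
    calc _ = (V.conjTranspose * V) * CFC.abs X * (V.conjTranspose * V) := by
          rw [hVV, one_mul, mul_one]
      _ = _ := by simp only [mul_assoc]
  rw [hback, hVc, hVdef, partialTranspose_kronecker_mul_mul, hdiag, Matrix.transpose_transpose,
    Matrix.transpose_transpose, ← Matrix.conjTranspose_kronecker]
  exact (posSemidef_abs _).conjTranspose_mul_mul_same _

end Pairing

/-! ### Measure-and-prepare maps. -/

section CompletelyPositive

variable {ι κ : Type*}

theorem IsCompletelyPositive.add {Ψ Ψ' : Matrix ι ι ℂ →ₗ[ℂ] Matrix κ κ ℂ}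
    (h : IsCompletelyPositive Ψ) (h' : IsCompletelyPositive Ψ') :
    IsCompletelyPositive (Ψ + Ψ') := fun k M hM => (h k M hM).add (h' k M hM)

theorem IsCompletelyPositive.map_posSemidef {Ψ : Matrix ι ι ℂ →ₗ[ℂ] Matrix κ κ ℂ}
    (h : IsCompletelyPositive Ψ) {X : Matrix ι ι ℂ} (hX : X.PosSemidef) : (Ψ X).PosSemidef :=
  (h 1 (X.submatrix Prod.snd Prod.snd) (hX.submatrix _)).submatrix (fun i => (0, i))

variable [Fintype ι]

/-- The measure-and-prepare map `X ↦ tr (E X) • σ`. -/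
def measurePrepare (E : Matrix ι ι ℂ) (σ : Matrix κ κ ℂ) :
    Matrix ι ι ℂ →ₗ[ℂ] Matrix κ κ ℂ where
  toFun X := (E * X).trace • σ
  map_add' X Y := by rw [mul_add, Matrix.trace_add, add_smul]
  map_smul' c X := by
    rw [Matrix.mul_smul, Matrix.trace_smul, smul_assoc, RingHom.id_apply]

theorem measurePrepare_apply (E X : Matrix ι ι ℂ) (σ : Matrix κ κ ℂ) :
    measurePrepare E σ X = (E * X).trace • σ := rfl

theorem isCompletelyPositive_measurePrepare [Fintype κ] [DecidableEq ι] {E : Matrix ι ι ℂ}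
    {σ : Matrix κ κ ℂ} (hE : E.PosSemidef) (hσ : σ.PosSemidef) :
    IsCompletelyPositive (measurePrepare E σ) := by
  intro k M hM
  obtain ⟨B, rfl⟩ := CStarAlgebra.nonneg_iff_eq_star_mul_self.1 hE.nonneg
  -- With `E = B† B`, `tr (E Y)` is a sum over the rows of `B`; `C β` is `id_k` tensored with the
  -- adjoint of row `β`. The output is then a positive `k × k` matrix tensored with `σ`.
  let C : ι → Matrix (Fin k × ι) (Fin k) ℂ := fun β =>
    Matrix.of fun x p => if x.1 = p then star (B β x.2) else 0
  have hN : (∑ β, (C β).conjTranspose * M * C β).PosSemidef :=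
    Matrix.posSemidef_sum _ fun β _ => hM.conjTranspose_mul_mul_same (C β)
  have hNσ := hN.kronecker hσ
  suffices h : (Matrix.of fun p q : Fin k × κ =>
      measurePrepare (star B * B) σ (Matrix.of fun x y => M (p.1, x) (q.1, y)) p.2 q.2)
      = (∑ β, (C β).conjTranspose * M * C β) ⊗ₖ σ by
    rw [h]
    exact hNσ
  ext p q
  simp only [Matrix.of_apply, measurePrepare_apply, Matrix.smul_apply, smul_eq_mul,
    Matrix.kroneckerMap_apply]
  congr 1
  rw [Matrix.sum_apply, mul_assoc, Matrix.trace_mul_comm, Matrix.trace]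
  refine Finset.sum_congr rfl fun β _ => ?_
  simp only [Matrix.diag_apply, Matrix.mul_apply, Matrix.conjTranspose_apply, Matrix.of_apply,
    Fintype.sum_prod_type, C, Matrix.star_apply]
  simp [apply_ite]

theorem partialTranspose_comp_measurePrepare {a b a' b' : Type*} [Fintype a'] [Fintype b']
    (E : Matrix (a' × b') (a' × b') ℂ) (σ : Matrix (a × b) (a × b) ℂ) :
    partialTranspose a b ∘ₗ measurePrepare E σ ∘ₗ partialTranspose a' b'
      = measurePrepare (partialTranspose a' b' E) (partialTranspose a b σ) := by
  refine LinearMap.ext fun X => ?_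
  simp only [LinearMap.comp_apply, measurePrepare_apply, map_smul, trace_mul_partialTranspose]

end CompletelyPositive

/-! ### The maximally entangled projector and the swap. -/

section MaxEntangled

variable {d : ℕ}

theorem isHermitian_maxEntangled (d : ℕ) : (maxEntangled d).IsHermitian := by
  ext p q
  simp only [maxEntangled, Matrix.conjTranspose_apply, Matrix.of_apply, apply_ite star]
  simp [and_comm]

theorem maxEntangled_mul_self (hd : 0 < d) : maxEntangled d * maxEntangled d = maxEntangled d := by
  have hd' : (d : ℂ) ≠ 0 := by exact_mod_cast hd.ne'
  ext p q
  simp only [maxEntangled, Matrix.mul_apply, Matrix.of_apply, Fintype.sum_prod_type]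
  by_cases hp : p.1 = p.2 <;> by_cases hq : q.1 = q.2 <;> simp [hp, hq, hd']

theorem trace_maxEntangled (hd : 0 < d) : (maxEntangled d).trace = 1 := by
  have hd' : (d : ℂ) ≠ 0 := by exact_mod_cast hd.ne'
  simp [maxEntangled, Matrix.trace, Fintype.sum_prod_type, hd']

theorem posSemidef_maxEntangled (hd : 0 < d) : (maxEntangled d).PosSemidef := by
  have h := Matrix.posSemidef_conjTranspose_mul_self (maxEntangled d)
  rwa [(isHermitian_maxEntangled d).eq, maxEntangled_mul_self hd] at h

theorem posSemidef_one_sub_maxEntangled (hd : 0 < d) : (1 - maxEntangled d).PosSemidef := by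
  have h := Matrix.posSemidef_conjTranspose_mul_self (1 - maxEntangled d)
  rwa [Matrix.conjTranspose_sub, Matrix.conjTranspose_one, (isHermitian_maxEntangled d).eq,
    mul_sub, sub_mul, sub_mul, maxEntangled_mul_self hd, one_mul, one_mul, mul_one, sub_self,
    sub_zero] at h

/-- The swap operator on `ℂ^d ⊗ ℂ^d`. -/
def swapMatrix (d : ℕ) : Matrix (Fin d × Fin d) (Fin d × Fin d) ℂ :=
  Matrix.of fun p q => if p = q.swap then 1 else 0

theorem partialTranspose_maxEntangled (d : ℕ) :
    partialTranspose (Fin d) (Fin d) (maxEntangled d) = (d : ℂ)⁻¹ • swapMatrix d := by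
  ext p q
  simp only [partialTranspose_apply, maxEntangled, swapMatrix, Matrix.of_apply, Matrix.smul_apply,
    smul_eq_mul, mul_ite, mul_one, mul_zero, Prod.ext_iff, Prod.fst_swap, Prod.snd_swap]
  congr 1
  rw [eq_comm (a := q.1), and_comm]

theorem isHermitian_swapMatrix (d : ℕ) : (swapMatrix d).IsHermitian := by
  ext p q
  simp only [swapMatrix, Matrix.conjTranspose_apply, Matrix.of_apply, apply_ite star, star_one,
    star_zero]
  congr 1
  rw [eq_iff_iff, Prod.swap_eq_iff_eq_swap.symm, eq_comm]

theorem swapMatrix_mul_self (d : ℕ) : swapMatrix d * swapMatrix d = 1 := by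
  ext p q
  simp only [swapMatrix, Matrix.mul_apply, Matrix.of_apply, Matrix.one_apply]
  rw [Finset.sum_eq_single q.swap] <;> simp +contextual

end MaxEntangled

/-! ### Converse, achievability and rates. -/

section Cost

variable {a b : Type*} [Fintype a] [DecidableEq a] [Fintype b] [DecidableEq b]

/-- A state obtained from `Φ_d` by a PPT operation has a partial transpose of trace norm at most
`d`. -/
theorem IsPPTOperation.traceNorm_partialTranspose_le {d : ℕ} (hd : 0 < d)
    {Ψ : Matrix (Fin d × Fin d) (Fin d × Fin d) ℂ →ₗ[ℂ] Matrix (a × b) (a × b) ℂ}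
    (hΨ : IsPPTOperation Ψ) :
    traceNorm (partialTranspose a b (Ψ (maxEntangled d))) ≤ d := by
  have hd' : (d : ℂ) ≠ 0 := by exact_mod_cast hd.ne'
  set Λ := partialTranspose a b ∘ₗ Ψ ∘ₗ partialTranspose (Fin d) (Fin d) with hΛ
  have htr : ∀ X, (Λ X).trace = X.trace := fun X => by
    rw [hΛ, LinearMap.comp_apply, LinearMap.comp_apply, trace_partialTranspose,
      hΨ.tracePreserving, trace_partialTranspose]
  have hc : (0 : ℂ) ≤ (2 * d : ℂ)⁻¹ := inv_nonneg.2 (mul_nonneg zero_le_two (Nat.cast_nonneg d))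
  have hP := hΨ.ppt.map_posSemidef ((posSemidef_one_add_of_involutive (isHermitian_swapMatrix d)
    (swapMatrix_mul_self d)).smul hc)
  have hQ := hΨ.ppt.map_posSemidef ((posSemidef_one_sub_of_involutive (isHermitian_swapMatrix d)
    (swapMatrix_mul_self d)).smul hc)
  -- `Φ_d^{T_A}` is the swap over `d`: a difference of positive matrices whose traces add up to `d`.
  have hdec : partialTranspose a b (Ψ (maxEntangled d))
      = Λ ((2 * d : ℂ)⁻¹ • (1 + swapMatrix d)) - Λ ((2 * d : ℂ)⁻¹ • (1 - swapMatrix d)) := by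
    have h1 : (2 * d : ℂ)⁻¹ • (1 + swapMatrix d) - (2 * d : ℂ)⁻¹ • (1 - swapMatrix d)
        = partialTranspose (Fin d) (Fin d) (maxEntangled d) := by
      rw [partialTranspose_maxEntangled, mul_inv]
      module
    rw [← map_sub, h1, hΛ, LinearMap.comp_apply, LinearMap.comp_apply,
      partialTranspose_partialTranspose]
  rw [hdec]
  refine (traceNorm_sub_le hP hQ).trans_eq ?_
  rw [htr, htr, ← Matrix.trace_add, ← smul_add, Matrix.trace_smul, add_add_sub_cancel,
    Matrix.trace_add, Matrix.trace_one, Fintype.card_prod, Fintype.card_fin]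
  have : (2 * d : ℂ)⁻¹ • (((d * d : ℕ) : ℂ) + ((d * d : ℕ) : ℂ)) = d := by
    rw [smul_eq_mul]
    push_cast
    field_simp
    ring
  rw [this, Complex.natCast_re]

/-- A state with vanishing binegativity is obtained from `Φ_d` by a PPT operation as soon as
`d ≥ ‖σ^{T_A}‖₁ + 1`. -/
theorem exists_isPPTOperation {σ : Matrix (a × b) (a × b) ℂ} (hσ : IsState σ)
    (hbin : (partialTranspose a b (CFC.abs (partialTranspose a b σ))).PosSemidef)
    (hpos : 0 < traceNorm (partialTranspose a b σ)) {d : ℕ}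
    (hd : traceNorm (partialTranspose a b σ) + 1 ≤ d) :
    ∃ Ψ : Matrix (Fin d × Fin d) (Fin d × Fin d) ℂ →ₗ[ℂ] Matrix (a × b) (a × b) ℂ,
      IsPPTOperation Ψ ∧ Ψ (maxEntangled d) = σ := by
  set X := partialTranspose a b σ with hX
  set t := traceNorm X with ht
  have hd0 : 0 < d := by
    have : (0 : ℝ) < d := by linarith
    exact_mod_cast this
  have hdC : (d : ℂ) ≠ 0 := by exact_mod_cast hd0.ne'
  have htC : (t : ℂ) ≠ 0 := by exact_mod_cast hpos.ne'
  -- The state prepared when the test for `Φ_d` fails; vanishing binegativity is exactly its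
  -- positivity.
  set τ := (t : ℂ)⁻¹ • partialTranspose a b (CFC.abs X) with hτ
  have hτpos : τ.PosSemidef := hbin.smul (inv_nonneg.2 (by exact_mod_cast hpos.le))
  have hτtr : τ.trace = 1 := by
    rw [hτ, Matrix.trace_smul, trace_partialTranspose, ← traceNorm_eq_trace, smul_eq_mul,
      inv_mul_cancel₀ htC]
  have hτpt : partialTranspose a b τ = (t : ℂ)⁻¹ • CFC.abs X := by
    rw [hτ, map_smul, partialTranspose_partialTranspose]
  have hXh : X.IsHermitian := isHermitian_partialTranspose hσ.posSemidef.isHermitian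
  refine ⟨measurePrepare (maxEntangled d) σ + measurePrepare (1 - maxEntangled d) τ,
    ⟨?_, ?_, ?_⟩, ?_⟩
  · exact (isCompletelyPositive_measurePrepare (posSemidef_maxEntangled hd0) hσ.posSemidef).add
      (isCompletelyPositive_measurePrepare (posSemidef_one_sub_maxEntangled hd0) hτpos)
  · intro Y
    rw [LinearMap.add_apply, measurePrepare_apply, measurePrepare_apply, Matrix.trace_add,
      Matrix.trace_smul, Matrix.trace_smul, hσ.trace_eq_one, hτtr, sub_mul, one_mul,
      Matrix.trace_sub]
    simp
  -- Regroup along the two eigenspaces of the swap. The coefficient `d - 1 - t` is where `d ≥ t + 1`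
  -- is needed.
  · have hsplit : partialTranspose a b ∘ₗ (measurePrepare (maxEntangled d) σ
          + measurePrepare (1 - maxEntangled d) τ) ∘ₗ partialTranspose (Fin d) (Fin d)
        = measurePrepare (1 + swapMatrix d)
            ((2 * d * t : ℂ)⁻¹ • ((((d - 1 - t : ℝ) : ℂ)) • CFC.abs X
              + (t : ℂ) • (CFC.abs X + X)))
          + measurePrepare (1 - swapMatrix d)
            ((2 * d * t : ℂ)⁻¹ • ((((d + 1 - t : ℝ) : ℂ)) • CFC.abs X
              + (t : ℂ) • (CFC.abs X - X))) := by
      rw [LinearMap.add_comp, LinearMap.comp_add, partialTranspose_comp_measurePrepare,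
        partialTranspose_comp_measurePrepare, map_sub, partialTranspose_one,
        partialTranspose_maxEntangled, hτpt, ← hX]
      refine LinearMap.ext fun Y => ?_
      simp only [LinearMap.add_apply, measurePrepare_apply, add_mul, sub_mul, Matrix.smul_mul,
        Matrix.trace_add, Matrix.trace_sub, Matrix.trace_smul, one_mul, smul_eq_mul, mul_inv]
      push_cast
      match_scalars <;> field_simp <;> ring
    have hc : (0 : ℂ) ≤ (2 * d * t : ℂ)⁻¹ := inv_nonneg.2 (by
      have : (0 : ℝ) ≤ 2 * d * t := by positivity
      exact_mod_cast this)
    have ht0 : (0 : ℂ) ≤ (t : ℂ) := by exact_mod_cast hpos.le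
    rw [hsplit]
    exact (isCompletelyPositive_measurePrepare
        (posSemidef_one_add_of_involutive (isHermitian_swapMatrix d) (swapMatrix_mul_self d))
        ((((posSemidef_abs X).smul (Complex.zero_le_real.2 (by linarith))).add
          ((posSemidef_abs_add hXh).smul ht0)).smul hc)).add
      (isCompletelyPositive_measurePrepare
        (posSemidef_one_sub_of_involutive (isHermitian_swapMatrix d) (swapMatrix_mul_self d))
        ((((posSemidef_abs X).smul (Complex.zero_le_real.2 (by linarith))).add
          ((posSemidef_abs_sub hXh).smul ht0)).smul hc))
  · rw [LinearMap.add_apply, measurePrepare_apply, measurePrepare_apply, sub_mul, one_mul,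
      maxEntangled_mul_self hd0, sub_self, trace_maxEntangled hd0]
    simp

/-- The negativity equals a coherence, which is a sum of nonnegative terms. -/
theorem IsPairingState.one_le_traceNorm {ρ : Matrix (a × b) (a × b) ℂ}
    (hρ : IsPairingState ρ) : 1 ≤ traceNorm (partialTranspose a b ρ) := by
  obtain ⟨-, UA, -, UB, -, h⟩ := hρ
  have h0 : 0 ≤ negativity ρ := by
    rw [h, coherenceL1]
    refine Finset.sum_nonneg fun i _ => Finset.sum_nonneg fun j _ => ?_
    split_ifs <;> positivity
  rw [negativity] at h0
  linarith

theorem logNegativity_le_of_isAchievableRate {ρ : Matrix (a × b) (a × b) ℂ}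
    (h1 : 1 ≤ traceNorm (partialTranspose a b ρ)) {r : ℝ} (hr : IsAchievableRate ρ r) :
    logNegativity ρ ≤ r := by
  obtain ⟨n, ⟨d, hd, hdr, Ψ, hΨ, hΨρ⟩, hn⟩ := (hr.and (Filter.eventually_gt_atTop 0)).exists
  have hle := hΨ.traceNorm_partialTranspose_le hd
  rw [hΨρ, partialTranspose_tensorPower, traceNorm_tensorPower] at hle
  have hn' : (0 : ℝ) < n := by exact_mod_cast hn
  have hlog := Real.logb_le_logb_of_le one_lt_two (by positivity) hle
  rw [Real.logb_pow] at hlog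
  rw [logNegativity, negativity, add_sub_cancel]
  refine le_of_mul_le_mul_left ?_ hn'
  linarith

theorem IsPairingState.isAchievableRate {ρ : Matrix (a × b) (a × b) ℂ}
    (hρ : IsPairingState ρ) {r : ℝ} (hr : logNegativity ρ < r) : IsAchievableRate ρ r := by
  have h1 := hρ.one_le_traceNorm
  rw [logNegativity, negativity, add_sub_cancel] at hr
  set t := traceNorm (partialTranspose a b ρ) with ht
  have htpos : 0 < t := by linarith
  have hts : t < 2 ^ r := (Real.logb_lt_iff_lt_rpow one_lt_two htpos).1 hr
  have hratio : 1 < 2 ^ r / t := (one_lt_div htpos).2 hts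
  -- The 3 absorbs rounding: `d = ⌈t ^ n⌉ + 1 < t ^ n + 2 ≤ 3 * t ^ n`, as `t ≥ 1`.
  filter_upwards [(tendsto_pow_atTop_atTop_of_one_lt hratio).eventually_ge_atTop 3] with n hn
  have htn : 1 ≤ t ^ n := one_le_pow₀ h1
  have hbound : 3 * t ^ n ≤ (2 : ℝ) ^ (r * n) := by
    rw [div_pow, le_div_iff₀ (by positivity)] at hn
    rwa [Real.rpow_mul_natCast zero_le_two]
  have hceil := Nat.ceil_lt_add_one (zero_le_one.trans htn)
  have hT : traceNorm (partialTranspose (Fin n → a) (Fin n → b) (tensorPower ρ n)) = t ^ n := by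
    rw [partialTranspose_tensorPower, traceNorm_tensorPower]
  refine ⟨⌈t ^ n⌉₊ + 1, Nat.succ_pos _, ?_, exists_isPPTOperation (hρ.1.tensorPower n) ?_ ?_ ?_⟩
  · rw [Real.logb_le_iff_le_rpow one_lt_two (by positivity)]
    push_cast
    linarith
  · rw [partialTranspose_tensorPower, abs_tensorPower, partialTranspose_tensorPower]
    exact posSemidef_tensorPower hρ.posSemidef_partialTranspose_abs n
  · rw [hT]
    positivity
  · rw [hT]
    push_cast
    linarith [Nat.le_ceil (t ^ n)]

end Cost

end PairingState

theorem mainTheorem7 {a b : Type*} [Fintype a] [DecidableEq a] [Fintype b] [DecidableEq b]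
    (ρ : Matrix (a × b) (a × b) ℂ) (hρ : PairingState.IsPairingState ρ) :
    PairingState.exactPPTCost ρ = ((PairingState.logNegativity ρ : ℝ) : EReal) := by
  refine le_antisymm ?_ ?_
  -- Only rates strictly above the logarithmic negativity are shown achievable; the infimum needs no
  -- more.
  · refine EReal.le_of_forall_lt_iff_le.1 fun r hr => ?_
    exact sInf_le ⟨r, hρ.isAchievableRate (EReal.coe_lt_coe_iff.1 hr), rfl⟩
  · refine le_sInf ?_
    rintro _ ⟨r, hr, rfl⟩
    exact EReal.coe_le_coe_iff.2
      (PairingState.logNegativity_le_of_isAchievableRate hρ.one_le_traceNorm hr)
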